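/- Let $C\subseteq\mathbb R^2$ be a rectifiable simple curve, i.e. $C=f([0,1])$ for some injective continuous $f:[0,1]\to\mathbb R^2$ of finite (Euclidean) length. For $\varepsilon>0$ and $z=(a,b)\in\mathbb R^2$ let $V_\varepsilon(z)=\{(x,y): |x-a|<\varepsilon,\ |y-b|<\varepsilon\}$, and for $A\subseteq\mathbb R^2$ let $V_\varepsilon(A)=\bigcup_{z\in A}V_\varepsilon(z)$; the Hausdorff distance is $d_H(A,B)=\inf\{\varepsilon: A\subseteq V_\varepsilon(B),\ B\subseteq V_\varepsilon(A)\}$. A rational neighborhood is a set $V_\varepsilon(z)$ with $z\in\mathbb Q^2$ and $\varepsilon\in\mathbb Q$, $\varepsilon>0$. The curve $C$ is called $K$-computable if there is a computable sequence $(Q_n)_{n\in\mathbb N}$ of finite sets of rational neighborhoods such that $C\subseteq\bigcup Q_n$ and $d_H(\bigcup Q_n,C)<2^{-n}$ for all $n\in\mathbb N$, where $\bigcup Q_n$ is the union of all neighborhoods in $Q_n$. A rational polygon is a nonempty finite sequence $p=[q_0,\dots,q_r]$ of points of $\mathbb Q^2$; it is identified with its (not necessarily simple) curve, the union of the line segments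 joining consecutive points (the single point $q_0$ if $r=0$). Then $C$ is $K$-computable if and only if there is a computable sequence $(p_n)_{n\in\mathbb N}$ of rational polygons such that $d_H(p_n,p_{n+1})\le 2^{-n}$ for all $n\in\mathbb N$ and $\lim_{n\to\infty} d_H(p_n,C)=0$. -/

import Mathlib

namespace CompCurve

/-! ### The plane, square neighbourhoods and the Hausdorff distance -/

/-- The plane `ℝ²` with its Euclidean metric. -/
abbrev Plane : Type := EuclideanSpace ℝ (Fin 2)

/-- The (open) `ε`-neighbourhood of a point `z = (a, b)`: the open square bounded by the lines
`x = a ± ε` and `y = b ± ε`. -/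
def nbhd (ε : ℝ) (z : Plane) : Set Plane :=
  {w | |w 0 - z 0| < ε ∧ |w 1 - z 1| < ε}

/-- The `ε`-neighbourhood of a set: the union of the `ε`-neighbourhoods of its points. -/
def setNbhd (ε : ℝ) (A : Set Plane) : Set Plane :=
  ⋃ z ∈ A, nbhd ε z

/-- The Hausdorff distance of two sets, with respect to square neighbourhoods. It is only used
for nonempty bounded sets, for which the infimum is over a nonempty set of positive reals. -/
noncomputable def hausdorffDistance (A B : Set Plane) : ℝ :=
  sInf {ε : ℝ | A ⊆ setNbhd ε B ∧ B ⊆ setNbhd ε A}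

/-! ### Simple rectifiable curves -/

/-- `f`, restricted to `[0, 1]`, is an injective continuous parametrization of `C`. -/
def IsInjectiveParametrization (f : ℝ → Plane) (C : Set Plane) : Prop :=
  ContinuousOn f (Set.Icc 0 1) ∧ Set.InjOn f (Set.Icc 0 1) ∧ f '' Set.Icc 0 1 = C

/-- The length of `f` on `[0, 1]`: the supremum of the Euclidean lengths of inscribed polygons. -/
noncomputable def paramLength (f : ℝ → Plane) : ENNReal :=
  eVariationOn f (Set.Icc 0 1)

/-- `C` is a simple (open) rectifiable plane curve: it has an injective continuous
parametrization of finite length. (The length does not depend on the choice of the injective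
parametrization.) -/
def IsRectifiableCurve (C : Set Plane) : Prop :=
  ∃ f : ℝ → Plane, IsInjectiveParametrization f C ∧ paramLength f < ⊤

/-! ### Computable sequences of finite rational objects -/

/-- A sequence `x` in `α` is computable with respect to a notation `ν` of the elements of `α` by
codes if some Turing computable function maps each `n` to a code of `x n`. -/
def IsComputableSeq {κ α : Type} [Primcodable κ] (ν : κ → α) (x : ℕ → α) : Prop :=
  ∃ g : ℕ → κ, Computable g ∧ ∀ n, ν (g n) = x n

/-- The triple `(a, b, c)` of naturals denotes the rational number `(a - b) / (c + 1)`. -/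
def ratOfCode (k : ℕ × ℕ × ℕ) : ℚ :=
  ((k.1 : ℚ) - (k.2.1 : ℚ)) / ((k.2.2 : ℚ) + 1)

/-- The pair `(a, b)` of naturals denotes the positive rational number `(a + 1) / (b + 1)`. -/
def posRatOfCode (k : ℕ × ℕ) : {r : ℚ // 0 < r} :=
  ⟨((k.1 : ℚ) + 1) / ((k.2 : ℚ) + 1), by positivity⟩

/-- Codes of rational points. -/
abbrev PointCode : Type := (ℕ × ℕ × ℕ) × (ℕ × ℕ × ℕ)

/-- The rational point denoted by a code. -/
def pointOfCode (k : PointCode) : ℚ × ℚ :=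
  (ratOfCode k.1, ratOfCode k.2)

/-- A rational point as a point of the plane. -/
noncomputable def ratPoint (q : ℚ × ℚ) : Plane :=
  !₂[(q.1 : ℝ), (q.2 : ℝ)]

/-! ### Rational neighbourhoods and K-computability -/

/-- A rational neighbourhood, given by its rational centre and its positive rational radius. -/
abbrev RatNbhd : Type := (ℚ × ℚ) × {r : ℚ // 0 < r}

/-- The point set of a rational neighbourhood (an open square). -/
noncomputable def RatNbhd.toSet (V : RatNbhd) : Set Plane :=
  nbhd ((V.2 : ℚ) : ℝ) (ratPoint V.1)

/-- The union of all neighbourhoods in a finite set of rational neighbourhoods. -/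
noncomputable def coverSet (Q : Finset RatNbhd) : Set Plane :=
  ⋃ V ∈ Q, RatNbhd.toSet V

/-- A finite list of codes denotes a finite set of rational neighbourhoods. -/
def coverOfCode (l : List (PointCode × (ℕ × ℕ))) : Finset RatNbhd :=
  (l.map fun k => ((pointOfCode k.1, posRatOfCode k.2) : RatNbhd)).toFinset

/-- `C` is `K`-computable: there is a computable sequence `(Q n)` of finite sets of rational
neighbourhoods with `C ⊆ ⋃ Q n` and `d_H (⋃ Q n, C) < 2⁻ⁿ` for all `n`. -/
def IsKComputable (C : Set Plane) : Prop :=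
  ∃ Q : ℕ → Finset RatNbhd, IsComputableSeq coverOfCode Q ∧
    ∀ n : ℕ, C ⊆ coverSet (Q n) ∧ hausdorffDistance (coverSet (Q n)) C < (1 / 2 : ℝ) ^ n

/-! ### Rational polygons -/

/-- A rational polygon `[q₀, …, q_r]`: a nonempty finite sequence of rational points, given as
its first point and the list of the remaining ones. -/
abbrev RatPolygon : Type := (ℚ × ℚ) × List (ℚ × ℚ)

/-- The union of the line segments joining consecutive points of `q :: l`
(the single point `q` if `l` is empty). -/
noncomputable def polygonalPath : ℚ × ℚ → List (ℚ × ℚ) → Set Plane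
  | q, [] => {ratPoint q}
  | q, r :: l => segment ℝ (ratPoint q) (ratPoint r) ∪ polygonalPath r l

/-- The curve of a rational polygon. -/
noncomputable def RatPolygon.curve (p : RatPolygon) : Set Plane :=
  polygonalPath p.1 p.2

/-- The rational polygon denoted by a code. -/
def polygonOfCode (k : PointCode × List PointCode) : RatPolygon :=
  (pointOfCode k.1, k.2.map pointOfCode)

end CompCurve

namespace CompCurve

open Set Filter Topology MeasureTheory

/-! ### Mutual `ε`-closeness of sets -/

/-! For nonempty bounded sets, bounds on the distance translate into the relation `AreClose ε`,
which is symmetric and adds its constants under composition.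

From polygons to coverings, the geometric step bounds give the explicit rate `d_H (p n) C ≤ 2 · 2⁻ⁿ`
(`hausdorffDistance_limit_le`). Squares of radius `4 · 2⁻ᵏ` about rational points with spacing `2⁻ᵏ`
on `p k` therefore cover `C` and stay near it (`coverSet_squaresCode`).

Conversely, the centres of a good covering lie near `C`, but `C` need not lie near the centres
unless the squares are small. Rectifiability supplies this: finite length gives Hausdorff dimension
at most 1, hence area zero, so the areas of the closed thickenings of the compact set `C` tend to 0
and thin neighbourhoods of `C` contain no square of a fixed size
(`IsRectifiableCurve.exists_not_nbhd_subset_setNbhd`). The squares of the coverings thus become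
small. Since `C` is connected, the centres of small squares can be joined in short steps into one
polygon, possibly with repeated vertices (`exists_isPolygonThrough`). The argument yields no
computable rate at which the squares shrink, so an unbounded search finds both the covering and the
polygon (`exists_computable_choice`). The search condition is decidable, and any hit is close to `C`
(`IsPolygonThrough.areClose`). -/

theorem mem_setNbhd {ε : ℝ} {A : Set Plane} {w : Plane} :
    w ∈ setNbhd ε A ↔ ∃ z ∈ A, w ∈ nbhd ε z := by
  simp [setNbhd]

theorem nbhd_symm {ε : ℝ} {w z : Plane} (h : w ∈ nbhd ε z) : z ∈ nbhd ε w := by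
  obtain ⟨h0, h1⟩ := h
  exact ⟨by rwa [abs_sub_comm], by rwa [abs_sub_comm]⟩

theorem nbhd_trans {ε δ : ℝ} {u v w : Plane} (h : u ∈ nbhd ε v) (h' : v ∈ nbhd δ w) :
    u ∈ nbhd (ε + δ) w :=
  ⟨(abs_sub_le _ (v 0) _).trans_lt (add_lt_add h.1 h'.1),
    (abs_sub_le _ (v 1) _).trans_lt (add_lt_add h.2 h'.2)⟩

theorem nbhd_mono {ε δ : ℝ} (h : ε ≤ δ) (z : Plane) : nbhd ε z ⊆ nbhd δ z :=
  fun _ hw => ⟨hw.1.trans_le h, hw.2.trans_le h⟩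

theorem mem_nbhd_self {ε : ℝ} (h : 0 < ε) (z : Plane) : z ∈ nbhd ε z := by
  simp [nbhd, h]

theorem pos_of_mem_nbhd {ε : ℝ} {w z : Plane} (h : w ∈ nbhd ε z) : 0 < ε :=
  (abs_nonneg _).trans_lt h.1

theorem setNbhd_mono {ε δ : ℝ} (h : ε ≤ δ) (A : Set Plane) : setNbhd ε A ⊆ setNbhd δ A := by
  intro w hw
  obtain ⟨z, hz, hwz⟩ := mem_setNbhd.1 hw
  exact mem_setNbhd.2 ⟨z, hz, nbhd_mono h z hwz⟩

theorem subset_setNbhd_self {ε : ℝ} (h : 0 < ε) (A : Set Plane) : A ⊆ setNbhd ε A :=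
  fun w hw => mem_setNbhd.2 ⟨w, hw, mem_nbhd_self h w⟩

theorem setNbhd_setNbhd_subset (ε δ : ℝ) (A : Set Plane) :
    setNbhd ε (setNbhd δ A) ⊆ setNbhd (ε + δ) A := by
  intro w hw
  obtain ⟨z, hz, hwz⟩ := mem_setNbhd.1 hw
  obtain ⟨y, hy, hzy⟩ := mem_setNbhd.1 hz
  exact mem_setNbhd.2 ⟨y, hy, nbhd_trans hwz hzy⟩

theorem setNbhd_subset_setNbhd {A B : Set Plane} (ε : ℝ) (h : A ⊆ B) :
    setNbhd ε A ⊆ setNbhd ε B :=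
  biUnion_subset_biUnion_left h

/-- Each of the sets `A` and `B` lies in the `ε`-neighbourhood of the other one. -/
def AreClose (ε : ℝ) (A B : Set Plane) : Prop :=
  A ⊆ setNbhd ε B ∧ B ⊆ setNbhd ε A

namespace AreClose

variable {ε δ : ℝ} {A B D : Set Plane}

theorem symm (h : AreClose ε A B) : AreClose ε B A :=
  ⟨h.2, h.1⟩

theorem mono (h : AreClose ε A B) (hεδ : ε ≤ δ) : AreClose δ A B :=
  ⟨h.1.trans (setNbhd_mono hεδ _), h.2.trans (setNbhd_mono hεδ _)⟩

theorem trans (h : AreClose ε A B) (h' : AreClose δ B D) : AreClose (ε + δ) A D :=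
  ⟨(h.1.trans (setNbhd_subset_setNbhd ε h'.1)).trans (setNbhd_setNbhd_subset _ _ _),
    ((h'.2.trans (setNbhd_subset_setNbhd δ h.2)).trans (setNbhd_setNbhd_subset _ _ _)).trans_eq
      (by rw [add_comm])⟩

theorem pos (h : AreClose ε A B) (hA : A.Nonempty) : 0 < ε := by
  obtain ⟨a, ha⟩ := hA
  obtain ⟨z, -, hz⟩ := mem_setNbhd.1 (h.1 ha)
  exact pos_of_mem_nbhd hz

/-- Nonemptiness forces every admissible radius to be positive, so the infimum is over a set bounded
below. -/
theorem hausdorffDistance_le (h : AreClose ε A B) (hA : A.Nonempty) :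
    hausdorffDistance A B ≤ ε :=
  csInf_le ⟨0, fun _ h' => (AreClose.pos h' hA).le⟩ h

end AreClose

/-! ### Square neighbourhoods and the Euclidean metric -/

theorem abs_coord_sub_le_dist (w z : Plane) (i : Fin 2) : |w i - z i| ≤ dist w z := by
  rw [dist_eq_norm]
  simpa using PiLp.norm_apply_le (w - z) i

theorem dist_le_add_abs (w z : Plane) : dist w z ≤ |w 0 - z 0| + |w 1 - z 1| := by
  rw [EuclideanSpace.dist_eq, Fin.sum_univ_two, Real.sqrt_le_left (by positivity), Real.dist_eq,
    Real.dist_eq]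
  nlinarith [abs_nonneg (w 0 - z 0), abs_nonneg (w 1 - z 1)]

theorem ball_subset_nbhd (ε : ℝ) (z : Plane) : Metric.ball z ε ⊆ nbhd ε z :=
  fun w hw => ⟨(abs_coord_sub_le_dist w z 0).trans_lt hw, (abs_coord_sub_le_dist w z 1).trans_lt hw⟩

theorem nbhd_subset_ball (ε : ℝ) (z : Plane) : nbhd ε z ⊆ Metric.ball z (2 * ε) :=
  fun w hw => (dist_le_add_abs w z).trans_lt (by linarith [hw.1, hw.2])

theorem isBounded_nbhd (ε : ℝ) (z : Plane) : Bornology.IsBounded (nbhd ε z) :=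
  Metric.isBounded_ball.subset (nbhd_subset_ball ε z)

theorem isOpen_nbhd (ε : ℝ) (z : Plane) : IsOpen (nbhd ε z) :=
  (isOpen_lt (f := fun w : Plane => |w 0 - z 0|) (by fun_prop) continuous_const).inter
    (isOpen_lt (f := fun w : Plane => |w 1 - z 1|) (by fun_prop) continuous_const)

theorem convex_nbhd (ε : ℝ) (z : Plane) : Convex ℝ (nbhd ε z) := by
  have h : ∀ i : Fin 2, Convex ℝ {w : Plane | |w i - z i| < ε} := by
    intro i
    have : {w : Plane | |w i - z i| < ε} =
        (EuclideanSpace.proj i : Plane →L[ℝ] ℝ) ⁻¹' Metric.ball (z i) ε := by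
      ext w
      simp [Real.dist_eq]
    rw [this]
    exact (convex_ball _ _).linear_preimage (EuclideanSpace.proj i : Plane →L[ℝ] ℝ).toLinearMap
  exact (h 0).inter (h 1)

theorem setNbhd_subset_cthickening (ε : ℝ) (A : Set Plane) :
    setNbhd ε A ⊆ Metric.cthickening (2 * ε) A := by
  intro w hw
  obtain ⟨z, hz, hwz⟩ := mem_setNbhd.1 hw
  exact Metric.mem_cthickening_of_dist_le _ _ _ _ hz (nbhd_subset_ball ε z hwz).le

/-- Bounded nonempty sets are close to each other for some `ε`. -/
theorem exists_areClose {A B : Set Plane} (hA : A.Nonempty) (hB : B.Nonempty)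
    (hA' : Bornology.IsBounded A) (hB' : Bornology.IsBounded B) : ∃ ε, AreClose ε A B := by
  obtain ⟨R, hR⟩ := Metric.isBounded_iff.1 (hA'.union hB')
  obtain ⟨a, ha⟩ := hA
  obtain ⟨b, hb⟩ := hB
  refine ⟨R + 1, fun w hw => mem_setNbhd.2 ⟨b, hb, ball_subset_nbhd _ _ ?_⟩,
    fun w hw => mem_setNbhd.2 ⟨a, ha, ball_subset_nbhd _ _ ?_⟩⟩
  · exact (hR (Or.inl hw) (Or.inr hb)).trans_lt (lt_add_one R)
  · exact (hR (Or.inr hw) (Or.inl ha)).trans_lt (lt_add_one R)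

/-- Nonemptiness and boundedness exclude the default value `sInf ∅ = 0`, which would say nothing
about closeness. -/
theorem areClose_of_hausdorffDistance_lt {ε : ℝ} {A B : Set Plane} (hA : A.Nonempty)
    (hB : B.Nonempty) (hA' : Bornology.IsBounded A) (hB' : Bornology.IsBounded B)
    (h : hausdorffDistance A B < ε) : AreClose ε A B := by
  obtain ⟨δ, hδ, hlt⟩ := exists_lt_of_csInf_lt (exists_areClose hA hB hA' hB') h
  exact AreClose.mono hδ hlt.le

theorem hausdorffDistance_nonneg {A B : Set Plane} (hA : A.Nonempty) :
    0 ≤ hausdorffDistance A B :=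
  Real.sInf_nonneg fun _ h => (AreClose.pos h hA).le

theorem hausdorffDistance_triangle {A B D : Set Plane} (hA : A.Nonempty) (hB : B.Nonempty)
    (hD : D.Nonempty) (hA' : Bornology.IsBounded A) (hB' : Bornology.IsBounded B)
    (hD' : Bornology.IsBounded D) :
    hausdorffDistance A D ≤ hausdorffDistance A B + hausdorffDistance B D := by
  refine le_of_forall_pos_le_add fun ε hε => ?_
  have h1 := areClose_of_hausdorffDistance_lt hA hB hA' hB'
    (lt_add_of_pos_right (hausdorffDistance A B) (half_pos hε))
  have h2 := areClose_of_hausdorffDistance_lt hB hD hB' hD'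
    (lt_add_of_pos_right (hausdorffDistance B D) (half_pos hε))
  exact ((h1.trans h2).hausdorffDistance_le hA).trans_eq (by ring)

/-- A sequence of sets with `d_H (A n) (A (n + 1)) ≤ 2⁻ⁿ` and limit `C` satisfies
`d_H (A n) C ≤ 2 · 2⁻ⁿ`. -/
theorem hausdorffDistance_limit_le {A : ℕ → Set Plane} {C : Set Plane}
    (hA : ∀ n, (A n).Nonempty) (hA' : ∀ n, Bornology.IsBounded (A n)) (hC : C.Nonempty)
    (hC' : Bornology.IsBounded C)
    (hstep : ∀ n, hausdorffDistance (A n) (A (n + 1)) ≤ (1 / 2 : ℝ) ^ n)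
    (hlim : Tendsto (fun n => hausdorffDistance (A n) C) atTop (𝓝 0)) (n : ℕ) :
    hausdorffDistance (A n) C ≤ 2 * (1 / 2 : ℝ) ^ n := by
  -- The step bounds from `n` to `j + n - 1` sum to `2 · 2⁻ⁿ - 2 · 2⁻⁽ʲ⁺ⁿ⁾`.
  have key : ∀ j, hausdorffDistance (A n) C ≤
      2 * (1 / 2 : ℝ) ^ n - 2 * (1 / 2 : ℝ) ^ (j + n) + hausdorffDistance (A (j + n)) C := by
    intro j
    induction j with
    | zero => simp
    | succ j ih =>
      have h1 := hausdorffDistance_triangle (hA (j + n)) (hA (j + n + 1)) hC (hA' _) (hA' _) hC'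
      have h2 := hstep (j + n)
      rw [show j + 1 + n = j + n + 1 by ring, pow_succ]
      linarith
  have hpow : Tendsto (fun j => (1 / 2 : ℝ) ^ (j + n)) atTop (𝓝 0) :=
    (tendsto_pow_atTop_nhds_zero_of_lt_one (by norm_num) (by norm_num)).comp
      (tendsto_add_atTop_nat n)
  have hsum := ((hpow.const_mul 2).const_sub (2 * (1 / 2 : ℝ) ^ n)).add
    (hlim.comp (tendsto_add_atTop_nat n))
  simp only [mul_zero, sub_zero, add_zero] at hsum
  exact ge_of_tendsto' hsum key

/-! ### Rectifiable curves are null sets -/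

/-- The arc-length parametrization has the same image and is 1-Lipschitz on a subset of `ℝ`, and
Lipschitz maps do not raise Hausdorff dimension. -/
theorem dimH_image_le_one_of_boundedVariationOn {f : ℝ → Plane} {s : Set ℝ}
    (hf : BoundedVariationOn f s) : dimH (f '' s) ≤ 1 := by
  rcases s.eq_empty_or_nonempty with rfl | ⟨a, ha⟩
  · simp
  have hl := hf.locallyBoundedVariationOn
  set φ := variationOnFromTo f s a
  set γ := naturalParameterization f s a
  have himage : f '' s = γ '' (φ '' s) := by
    rw [image_image]
    exact image_congr fun b hb =>
      (edist_eq_zero.1 (edist_naturalParameterization_eq_zero hl ha hb)).symm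
  have hspeed := has_unit_speed_naturalParameterization f hl ha
  have hlip : LipschitzOnWith 1 γ (φ '' s) := by
    have hle : ∀ x ∈ φ '' s, ∀ y ∈ φ '' s, x ≤ y → edist (γ x) (γ y) ≤ edist x y := by
      intro x hx y hy hxy
      have h1 := eVariationOn.edist_le γ (s := φ '' s ∩ Icc x y) (x := x) (y := y)
        ⟨hx, le_rfl, hxy⟩ ⟨hy, hxy, le_rfl⟩
      rw [hspeed hx hy] at h1
      rw [edist_comm x, edist_dist y, Real.dist_eq, abs_of_nonneg (sub_nonneg.2 hxy)]
      simpa using h1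
    intro x hx y hy
    rw [ENNReal.coe_one, one_mul]
    rcases le_total x y with h | h
    · exact hle x hx y hy h
    · rw [edist_comm, edist_comm x]
      exact hle y hy x hx h
  rw [himage]
  exact hlip.dimH_image_le.trans ((dimH_mono (subset_univ _)).trans_eq Real.dimH_univ)

namespace IsRectifiableCurve

variable {C : Set Plane}

theorem isCompact (hC : IsRectifiableCurve C) : IsCompact C := by
  obtain ⟨f, ⟨hf, -, rfl⟩, -⟩ := hC
  exact isCompact_Icc.image_of_continuousOn hf

theorem isPreconnected (hC : IsRectifiableCurve C) : IsPreconnected C := by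
  obtain ⟨f, ⟨hf, -, rfl⟩, -⟩ := hC
  exact isPreconnected_Icc.image f hf

theorem nonempty (hC : IsRectifiableCurve C) : C.Nonempty := by
  obtain ⟨f, ⟨-, -, rfl⟩, -⟩ := hC
  exact (nonempty_Icc.2 zero_le_one).image f

theorem dimH_le_one (hC : IsRectifiableCurve C) : dimH C ≤ 1 := by
  obtain ⟨f, ⟨-, -, rfl⟩, h⟩ := hC
  exact dimH_image_le_one_of_boundedVariationOn h.ne

/-- The thin neighbourhoods of a rectifiable curve contain no square of a given size. -/
theorem exists_not_nbhd_subset_setNbhd (hC : IsRectifiableCurve C) {r : ℝ} (hr : 0 < r) :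
    ∃ δ > 0, ∀ z, ¬ nbhd r z ⊆ setNbhd δ C := by
  let μ : Measure Plane := μH[2]
  have : μ.IsAddHaarMeasure := by
    simpa using isAddHaarMeasure_hausdorffMeasure (E := Plane)
  have hnull : μ C = 0 :=
    hausdorffMeasure_of_dimH_lt (d := 2) (hC.dimH_le_one.trans_lt (by norm_num))
  have hlim := tendsto_measure_cthickening_of_isCompact (μ := μ) hC.isCompact
  rw [hnull] at hlim
  have hball : 0 < μ (Metric.ball 0 r) := Metric.measure_ball_pos μ 0 hr
  obtain ⟨η, hη, hlt⟩ := Metric.eventually_nhds_iff.1 (hlim.eventually (gt_mem_nhds hball))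
  -- The square `δ`-neighbourhood lies in the Euclidean closed `2 δ`-thickening, and `2 · (η / 4) <
  -- η`.
  refine ⟨η / 4, by positivity, fun z hz => ?_⟩
  have h1 : μ (Metric.cthickening (2 * (η / 4)) C) < μ (Metric.ball 0 r) := by
    apply hlt
    rw [Real.dist_eq, sub_zero, abs_of_pos (by positivity)]
    linarith
  have h2 : μ (Metric.ball z r) ≤ μ (Metric.cthickening (2 * (η / 4)) C) :=
    measure_mono (((ball_subset_nbhd r z).trans hz).trans (setNbhd_subset_cthickening _ _))
  rw [Measure.addHaar_ball_center] at h2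
  exact absurd h1 h2.not_gt

end IsRectifiableCurve

/-! ### Consecutive pairs of a list and polygons -/

/-- The pairs of consecutive entries of a list, followed by the last entry paired with itself. -/
def consecutivePairs {α : Type*} : List α → List (α × α)
  | [] => []
  | a :: l => (a, l.head?.getD a) :: consecutivePairs l

section ConsecutivePairs

variable {α : Type*}

theorem fst_mem_of_mem_consecutivePairs {w : List α} {e : α × α} (he : e ∈ consecutivePairs w) :
    e.1 ∈ w := by
  induction w with
  | nil => simp [consecutivePairs] at he
  | cons a l ih =>
    rcases List.mem_cons.1 he with rfl | he
    · exact List.mem_cons_self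
    · exact List.mem_cons_of_mem _ (ih he)

theorem exists_mem_consecutivePairs {w : List α} {a : α} (ha : a ∈ w) :
    ∃ e ∈ consecutivePairs w, e.1 = a := by
  induction w with
  | nil => simp at ha
  | cons b l ih =>
    rcases List.mem_cons.1 ha with rfl | ha
    · exact ⟨_, List.mem_cons_self, rfl⟩
    · obtain ⟨e, he, h⟩ := ih ha
      exact ⟨e, List.mem_cons_of_mem _ he, h⟩

theorem rel_of_mem_consecutivePairs {R : α → α → Prop} (hR : ∀ a, R a a) {w : List α}
    (hw : w.IsChain R) {e : α × α} (he : e ∈ consecutivePairs w) : R e.1 e.2 := by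
  induction w with
  | nil => simp [consecutivePairs] at he
  | cons a l ih =>
    rcases List.mem_cons.1 he with rfl | he
    · cases l with
      | nil => exact hR a
      | cons b l => exact (List.isChain_cons_cons.1 hw).1
    · exact ih hw.tail he

/-- If any two entries of `L` are joined by an `R`-path in `L`, then some `R`-path in `L` visits
all of `L`. -/
theorem exists_isChain_of_reflTransGen {R : α → α → Prop} {L : List α}
    (hR : ∀ a b, R a b → b ∈ L) (hL : ∀ a ∈ L, ∀ b ∈ L, Relation.ReflTransGen R a b)
    (T : List α) (hT : ∀ x ∈ T, x ∈ L) :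
    ∀ a ∈ L, ∃ l : List α, (a :: l).IsChain R ∧ (∀ x ∈ T, x ∈ a :: l) ∧ ∀ x ∈ a :: l, x ∈ L := by
  induction T with
  | nil => exact fun a ha => ⟨[], by simp, by simp, by simpa using ha⟩
  | cons b T ih =>
    intro a ha
    have hb := hT b List.mem_cons_self
    have path := hL a ha b hb
    -- The path from `a` to `b` is prepended vertex by vertex to a chain that starts at `b` and
    -- visits the rest of `T`.
    induction path using Relation.ReflTransGen.head_induction_on with
    | refl =>
      obtain ⟨l, h1, h2, h3⟩ := ih (fun x hx => hT x (List.mem_cons_of_mem _ hx)) b hb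
      exact ⟨l, h1, by simpa using h2, h3⟩
    | @head a c hac _ ih' =>
      obtain ⟨l, h1, h2, h3⟩ := ih' (hR a c hac)
      refine ⟨c :: l, List.isChain_cons_cons.2 ⟨hac, h1⟩,
        fun x hx => List.mem_cons_of_mem _ (h2 x hx), fun x hx => ?_⟩
      rcases List.mem_cons.1 hx with rfl | hx
      · exact ha
      · exact h3 x hx

end ConsecutivePairs

/-- The centres of squares of radius `δ` that cover a connected set, and all meet it, are joined by
paths with steps shorter than `2 δ`. -/
theorem reflTransGen_of_isPreconnected {κ : Type*} {C : Set Plane} (hC : IsPreconnected C)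
    {L : List κ} {c : κ → Plane} {δ : ℝ} (hcov : ∀ x ∈ C, ∃ i ∈ L, x ∈ nbhd δ (c i))
    (hmeet : ∀ i ∈ L, ∃ x ∈ C, x ∈ nbhd δ (c i)) (i : κ) (hi : i ∈ L) (j : κ) (hj : j ∈ L) :
    Relation.ReflTransGen (fun a b => b ∈ L ∧ c b ∈ nbhd (2 * δ) (c a)) i j := by
  set R : κ → κ → Prop := fun a b => b ∈ L ∧ c b ∈ nbhd (2 * δ) (c a)
  by_contra hij
  -- If `j` were unreachable from `i`, the squares with reachable and with unreachable centres would
  -- form two open sets that cover `C` and both meet it. By connectedness a square of each kind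
  -- share a point, so their centres are one step apart.
  let U : Set Plane := ⋃ a ∈ {a | a ∈ L ∧ Relation.ReflTransGen R i a}, nbhd δ (c a)
  let V : Set Plane := ⋃ a ∈ {a | a ∈ L ∧ ¬ Relation.ReflTransGen R i a}, nbhd δ (c a)
  have hU : IsOpen U := isOpen_biUnion fun _ _ => isOpen_nbhd _ _
  have hV : IsOpen V := isOpen_biUnion fun _ _ => isOpen_nbhd _ _
  have hUV : C ⊆ U ∪ V := by
    intro x hx
    obtain ⟨a, ha, hxa⟩ := hcov x hx
    by_cases h : Relation.ReflTransGen R i a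
    · exact Or.inl (mem_biUnion (show a ∈ {a | a ∈ L ∧ _} from ⟨ha, h⟩) hxa)
    · exact Or.inr (mem_biUnion (show a ∈ {a | a ∈ L ∧ _} from ⟨ha, h⟩) hxa)
  obtain ⟨x, hx, hxi⟩ := hmeet i hi
  obtain ⟨y, hy, hyj⟩ := hmeet j hj
  obtain ⟨z, -, hzU, hzV⟩ := hC U V hU hV hUV
    ⟨x, hx, mem_biUnion (show i ∈ {a | a ∈ L ∧ _} from ⟨hi, .refl⟩) hxi⟩
    ⟨y, hy, mem_biUnion (show j ∈ {a | a ∈ L ∧ _} from ⟨hj, hij⟩) hyj⟩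
  obtain ⟨a, ⟨-, ha⟩, hza⟩ := mem_iUnion₂.1 hzU
  obtain ⟨b, ⟨hb, hb'⟩, hzb⟩ := mem_iUnion₂.1 hzV
  refine hb' (ha.tail ⟨hb, ?_⟩)
  have := nbhd_trans (nbhd_symm hzb) hza
  rwa [← two_mul] at this

/-- The point of the plane denoted by a code. -/
noncomputable def planePoint (k : PointCode) : Plane :=
  ratPoint (pointOfCode k)

theorem planePoint_apply_zero (k : PointCode) : planePoint k 0 = (ratOfCode k.1 : ℝ) := by
  simp [planePoint, ratPoint, pointOfCode]

theorem planePoint_apply_one (k : PointCode) : planePoint k 1 = (ratOfCode k.2 : ℝ) := by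
  simp [planePoint, ratPoint, pointOfCode]

/-- The last vertex, paired with itself, adds only a degenerate segment, which is the whole curve
when the polygon is a single point. -/
theorem curve_polygonOfCode (k : PointCode × List PointCode) :
    (polygonOfCode k).curve =
      ⋃ e ∈ consecutivePairs (k.1 :: k.2), segment ℝ (planePoint e.1) (planePoint e.2) := by
  obtain ⟨q, l⟩ := k
  simp only [polygonOfCode, RatPolygon.curve]
  induction l generalizing q with
  | nil => simp [polygonalPath, consecutivePairs, planePoint]
  | cons r l ih =>
    rw [List.map_cons, polygonalPath, ih,
      show consecutivePairs (q :: r :: l) = (q, r) :: consecutivePairs (r :: l) from rfl]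
    simp only [List.mem_cons, iUnion_iUnion_eq_or_left]
    rfl

theorem nonempty_curve (p : RatPolygon) : p.curve.Nonempty := by
  obtain ⟨q, l⟩ := p
  cases l with
  | nil => exact ⟨_, rfl⟩
  | cons r l => exact ⟨_, Or.inl (left_mem_segment ℝ _ _)⟩

theorem isBounded_segment (x y : Plane) : Bornology.IsBounded (segment ℝ x y) := by
  rw [← convexHull_pair]
  exact (isBounded_convexHull (s := {x, y})).2 (Set.toFinite _).isBounded

theorem isBounded_curve (p : RatPolygon) : Bornology.IsBounded p.curve := by
  obtain ⟨q, l⟩ := p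
  simp only [RatPolygon.curve]
  induction l generalizing q with
  | nil => exact Bornology.isBounded_singleton
  | cons r l ih => exact (isBounded_segment _ _).union (ih r)

/-- A polygon with short edges is close to its set of vertices. -/
theorem areClose_curve_vertices {k : PointCode × List PointCode} {δ : ℝ} (hδ : 0 < δ)
    (h : ∀ e ∈ consecutivePairs (k.1 :: k.2), planePoint e.2 ∈ nbhd δ (planePoint e.1)) :
    AreClose δ (polygonOfCode k).curve (planePoint '' {v | v ∈ k.1 :: k.2}) := by
  rw [curve_polygonOfCode]
  constructor
  · intro x hx
    obtain ⟨e, he, hxe⟩ := mem_iUnion₂.1 hx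
    exact mem_setNbhd.2 ⟨planePoint e.1, ⟨e.1, fst_mem_of_mem_consecutivePairs he, rfl⟩,
      (convex_nbhd _ _).segment_subset (mem_nbhd_self hδ _) (h e he) hxe⟩
  · refine Subset.trans ?_ (subset_setNbhd_self hδ _)
    rintro _ ⟨v, hv, rfl⟩
    obtain ⟨e, he, rfl⟩ := exists_mem_consecutivePairs hv
    exact mem_biUnion (show e ∈ {e | e ∈ consecutivePairs (k.1 :: k.2)} from he)
      (left_mem_segment ℝ _ _)

/-! ### Subdivision of segments -/

/-- The code of `(1 - j / N) x + (j / N) y`. -/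
def interpolationCode (N j : ℕ) (x y : ℕ × ℕ × ℕ) : ℕ × ℕ × ℕ :=
  ((N - j) * (x.1 * (y.2.2 + 1)) + j * (y.1 * (x.2.2 + 1)),
    (N - j) * (x.2.1 * (y.2.2 + 1)) + j * (y.2.1 * (x.2.2 + 1)),
    N * ((x.2.2 + 1) * (y.2.2 + 1)) - 1)

/-- Codes store the denominator minus one, hence the `- 1` in the last entry. The conditions `0 < N`
and `j ≤ N` make the truncated subtractions exact. -/
theorem ratOfCode_interpolationCode {N j : ℕ} (hN : 0 < N) (hj : j ≤ N) (x y : ℕ × ℕ × ℕ) :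
    ratOfCode (interpolationCode N j x y) =
      (1 - (j : ℚ) / N) * ratOfCode x + (j : ℚ) / N * ratOfCode y := by
  have hden : (((N * ((x.2.2 + 1) * (y.2.2 + 1)) - 1 : ℕ) : ℚ) + 1) =
      N * (((x.2.2 : ℚ) + 1) * ((y.2.2 : ℚ) + 1)) := by
    rw [Nat.cast_sub (Nat.mul_pos hN (by positivity))]
    push_cast
    ring
  have hN' : (N : ℚ) ≠ 0 := by positivity
  have hx : (x.2.2 : ℚ) + 1 ≠ 0 := by positivity
  have hy : (y.2.2 : ℚ) + 1 ≠ 0 := by positivity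
  simp only [ratOfCode, interpolationCode, hden]
  push_cast [Nat.cast_sub hj]
  field_simp
  ring

/-- The code of the point dividing the segment `e` in the ratio `j : N - j`. -/
def divisionPoint (N j : ℕ) (e : PointCode × PointCode) : PointCode :=
  (interpolationCode N j e.1.1 e.2.1, interpolationCode N j e.1.2 e.2.2)

theorem planePoint_divisionPoint {N j : ℕ} (hN : 0 < N) (hj : j ≤ N) (e : PointCode × PointCode) :
    planePoint (divisionPoint N j e) =
      (1 - (j : ℝ) / N) • planePoint e.1 + ((j : ℝ) / N) • planePoint e.2 := by
  ext i
  fin_cases i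
  · simp [planePoint_apply_zero, divisionPoint, ratOfCode_interpolationCode hN hj]
  · simp [planePoint_apply_one, divisionPoint, ratOfCode_interpolationCode hN hj]

/-- A bound for the difference of two coded rational numbers. -/
def codeBound (x y : ℕ × ℕ × ℕ) : ℕ :=
  (x.1 + x.2.1) + (y.1 + y.2.1)

theorem abs_ratOfCode_le (x : ℕ × ℕ × ℕ) : |ratOfCode x| ≤ x.1 + x.2.1 := by
  rw [ratOfCode, abs_div, abs_of_pos (by positivity : (0 : ℚ) < x.2.2 + 1)]
  refine (div_le_self (abs_nonneg _) (by simp)).trans ((abs_sub _ _).trans ?_)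
  simp

theorem abs_ratOfCode_sub_le (x y : ℕ × ℕ × ℕ) :
    |(ratOfCode y : ℝ) - ratOfCode x| ≤ codeBound x y := by
  have h : |ratOfCode y - ratOfCode x| ≤ codeBound x y := by
    refine (abs_sub _ _).trans ?_
    rw [codeBound, Nat.cast_add, add_comm]
    push_cast
    exact add_le_add (abs_ratOfCode_le x) (abs_ratOfCode_le y)
  exact_mod_cast h

/-- The number of parts of length less than `2⁻ᵏ` into which the segment `e` is divided. -/
def divisionCount (k : ℕ) (e : PointCode × PointCode) : ℕ :=
  2 ^ k * (codeBound e.1.1 e.2.1 + codeBound e.1.2 e.2.2 + 1)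

/-- Codes of points that divide the segment `e` into parts of length less than `2⁻ᵏ`. -/
def divisionPoints (k : ℕ) (e : PointCode × PointCode) : List PointCode :=
  (List.range (divisionCount k e + 1)).map fun j => divisionPoint (divisionCount k e) j e

theorem divisionCount_pos (k : ℕ) (e : PointCode × PointCode) : 0 < divisionCount k e := by
  unfold divisionCount
  positivity

theorem planePoint_mem_segment {k : ℕ} {e : PointCode × PointCode} {v : PointCode}
    (hv : v ∈ divisionPoints k e) : planePoint v ∈ segment ℝ (planePoint e.1) (planePoint e.2) := by
  obtain ⟨j, hj, rfl⟩ := List.mem_map.1 hv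
  have hj : j ≤ divisionCount k e := Nat.lt_succ_iff.1 (List.mem_range.1 hj)
  have hN := divisionCount_pos k e
  have hN' : (0 : ℝ) < divisionCount k e := by exact_mod_cast hN
  rw [planePoint_divisionPoint hN hj, segment_eq_image]
  exact ⟨_, ⟨by positivity, (div_le_one hN').2 (by exact_mod_cast hj)⟩, rfl⟩

/-- Rounding the parameter down to a multiple of `1 / N` moves each coordinate by at most its
variation along the segment over `N`. The `+ 1` in `divisionCount` makes the resulting bound strict.
-/
theorem exists_mem_divisionPoints (k : ℕ) {e : PointCode × PointCode} {z : Plane}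
    (hz : z ∈ segment ℝ (planePoint e.1) (planePoint e.2)) :
    ∃ v ∈ divisionPoints k e, z ∈ nbhd ((1 / 2) ^ k) (planePoint v) := by
  rw [segment_eq_image] at hz
  obtain ⟨t, ⟨ht0, ht1⟩, rfl⟩ := hz
  have hN := divisionCount_pos k e
  set N := divisionCount k e with hNdef
  have hN' : (0 : ℝ) < N := by exact_mod_cast hN
  set j := ⌊t * N⌋₊
  have hj1 : (j : ℝ) ≤ t * N := Nat.floor_le (by positivity)
  have hj2 : t * N < j + 1 := Nat.lt_floor_add_one _
  have hjN : j ≤ N := by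
    have : (j : ℝ) ≤ N := hj1.trans (mul_le_of_le_one_left hN'.le ht1)
    exact_mod_cast this
  refine ⟨divisionPoint N j e, List.mem_map.2 ⟨j, List.mem_range.2 (Nat.lt_succ_of_le hjN), rfl⟩, ?_⟩
  have habs : |t - j / N| ≤ 1 / N := by
    rw [abs_of_nonneg (sub_nonneg.2 ((div_le_iff₀ hN').2 hj1)), sub_le_iff_le_add, ← add_div,
      le_div_iff₀ hN']
    linarith
  have main : ∀ a b : ℝ, |b - a| < codeBound e.1.1 e.2.1 + codeBound e.1.2 e.2.2 + 1 →
      |(1 - t) * a + t * b - ((1 - j / N) * a + j / N * b)| < (1 / 2 : ℝ) ^ k := by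
    intro a b hab
    rw [show (1 - t) * a + t * b - ((1 - j / N) * a + j / N * b) = (t - j / N) * (b - a) by ring,
      abs_mul]
    refine (mul_le_mul_of_nonneg_right habs (abs_nonneg _)).trans_lt ?_
    rw [one_div_mul_eq_div, div_lt_iff₀ hN', hNdef, divisionCount]
    push_cast
    rw [← mul_assoc, ← mul_pow]
    norm_num
    exact hab
  rw [planePoint_divisionPoint hN hjN]
  constructor
  · simp only [PiLp.add_apply, PiLp.smul_apply, smul_eq_mul, planePoint_apply_zero]
    refine main _ _ ((abs_ratOfCode_sub_le _ _).trans_lt ?_)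
    norm_cast
    lia
  · simp only [PiLp.add_apply, PiLp.smul_apply, smul_eq_mul, planePoint_apply_one]
    refine main _ _ ((abs_ratOfCode_sub_le _ _).trans_lt ?_)
    norm_cast
    lia

/-! ### Computability -/

/-- A computable relation with `∀ n, ∃ b, P n b` has a computable choice function. -/
theorem exists_computable_choice {β : Type} [Primcodable β] {P : ℕ → β → Prop}
    (hP : ComputablePred fun p : ℕ × β => P p.1 p.2) (h : ∀ n, ∃ b, P n b) :
    ∃ f : ℕ → β, Computable f ∧ ∀ n, P n (f n) := by
  obtain ⟨c, hc, hcP⟩ : ∃ c : ℕ × β → Bool, Computable c ∧ ∀ n b, c (n, b) = true ↔ P n b := by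
    obtain ⟨hdec, hP⟩ := hP
    exact ⟨_, hP, fun n b => @decide_eq_true_iff (P n b) (hdec (n, b))⟩
  -- `F n N` returns the element coded by `N` if it satisfies `P n`, so the least successful `N` is
  -- found by unbounded search.
  let F : ℕ → ℕ → Option β := fun n N =>
    (Encodable.decode (α := β) N).bind fun b => bif c (n, b) then some b else none
  have hF : Computable₂ F := by
    have harg : Computable fun q : (ℕ × ℕ) × β => (q.1.1, q.2) :=
      (Computable.fst.comp Computable.fst).pair Computable.snd
    have hsnd : Computable fun q : (ℕ × ℕ) × β => some q.2 :=
      Computable.option_some.comp Computable.snd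
    have hbody : Computable₂ fun (p : ℕ × ℕ) (b : β) => bif c (p.1, b) then some b else none :=
      Computable.cond (hc.comp harg) hsnd (Computable.const none)
    have hdecode : Computable fun p : ℕ × ℕ => Encodable.decode (α := β) p.2 :=
      Computable.decode.comp Computable.snd
    exact Computable.option_bind hdecode hbody
  have hmem : ∀ n N b, b ∈ F n N → P n b := by
    intro n N b hb
    obtain ⟨d, -, hd⟩ := Option.bind_eq_some_iff.1 (Option.mem_def.1 hb)
    rw [← hcP]
    cases hdc : c (n, d) with
    | false => simp [hdc] at hd
    | true =>
      have : d = b := by simpa [hdc] using hd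
      exact this ▸ hdc
  have hdom : ∀ n, (Nat.rfindOpt (F n)).Dom := by
    intro n
    obtain ⟨b, hb⟩ := h n
    exact Nat.rfindOpt_dom.2 ⟨Encodable.encode b, b, by simp [F, (hcP n b).2 hb]⟩
  refine ⟨fun n => (Nat.rfindOpt (F n)).get (hdom n),
    (Partrec.rfindOpt hF).of_eq fun n => (Part.some_get (hdom n)).symm, fun n => ?_⟩
  obtain ⟨N, hN⟩ := Nat.rfindOpt_spec (Part.get_mem (hdom n))
  exact hmem n N _ hN

/-! ### Primitive recursive operations on codes -/

section Primrec

variable {α β : Type} [Primcodable α] [Primcodable β]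

theorem primrec_add {f g : α → ℕ} (hf : Primrec f) (hg : Primrec g) :
    Primrec fun a => f a + g a :=
  Primrec.nat_add.comp hf hg

theorem primrec_sub {f g : α → ℕ} (hf : Primrec f) (hg : Primrec g) :
    Primrec fun a => f a - g a :=
  Primrec.nat_sub.comp hf hg

theorem primrec_mul {f g : α → ℕ} (hf : Primrec f) (hg : Primrec g) :
    Primrec fun a => f a * g a :=
  Primrec.nat_mul.comp hf hg

theorem primrec_two_pow {f : α → ℕ} (hf : Primrec f) : Primrec fun a => 2 ^ f a :=
  (Primrec₂.unpaired'.1 Nat.Primrec.pow).comp (Primrec.const 2) hf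

theorem primrec_succ {f : α → ℕ} (hf : Primrec f) : Primrec fun a => f a + 1 :=
  Primrec.succ.comp hf

/-- The given covering sequence is only computable. It enters the search condition as an argument of
a primitive recursive predicate. -/
theorem PrimrecPred.comp_computable {p : β → Prop} {f : α → β} (hp : PrimrecPred p)
    (hf : Computable f) : ComputablePred fun a => p (f a) := by
  obtain ⟨hdec, hp⟩ := hp
  exact ⟨fun a => hdec (f a), hp.to_comp.comp hf⟩

theorem primrec_consecutivePairs : Primrec (consecutivePairs : List α → List (α × α)) := by
  have h : Primrec₂ fun (_ : List α) (p : α × List α × List (α × α)) =>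
      (p.1, p.2.1.head?.getD p.1) :: p.2.2 := by
    have hp : Primrec fun q : List α × (α × List α × List (α × α)) => q.2 := Primrec.snd
    have h1 := Primrec.fst.comp hp
    have h2 := Primrec.fst.comp (Primrec.snd.comp hp)
    have h3 := Primrec.snd.comp (Primrec.snd.comp hp)
    exact Primrec.list_cons.comp
      (h1.pair (Primrec.option_getD.comp (Primrec.list_head?.comp h2) h1)) h3
  refine (Primrec.list_rec Primrec.id (Primrec.const []) h).of_eq fun l => ?_
  induction l with
  | nil => rfl
  | cons a l ih => simpa [consecutivePairs] using ih

theorem primrec_interpolationCode {N j : α → ℕ} {x y : α → ℕ × ℕ × ℕ} (hN : Primrec N)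
    (hj : Primrec j) (hx : Primrec x) (hy : Primrec y) :
    Primrec fun a => interpolationCode (N a) (j a) (x a) (y a) := by
  have hx1 := Primrec.fst.comp hx
  have hx2 := Primrec.fst.comp (Primrec.snd.comp hx)
  have hx3 := primrec_succ (Primrec.snd.comp (Primrec.snd.comp hx))
  have hy1 := Primrec.fst.comp hy
  have hy2 := Primrec.fst.comp (Primrec.snd.comp hy)
  have hy3 := primrec_succ (Primrec.snd.comp (Primrec.snd.comp hy))
  exact (primrec_add (primrec_mul (primrec_sub hN hj) (primrec_mul hx1 hy3))
      (primrec_mul hj (primrec_mul hy1 hx3))).pair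
    ((primrec_add (primrec_mul (primrec_sub hN hj) (primrec_mul hx2 hy3))
      (primrec_mul hj (primrec_mul hy2 hx3))).pair
      (primrec_sub (primrec_mul hN (primrec_mul hx3 hy3)) (Primrec.const 1)))

theorem primrec_codeBound {x y : α → ℕ × ℕ × ℕ} (hx : Primrec x) (hy : Primrec y) :
    Primrec fun a => codeBound (x a) (y a) :=
  primrec_add
    (primrec_add (Primrec.fst.comp hx) (Primrec.fst.comp (Primrec.snd.comp hx)))
    (primrec_add (Primrec.fst.comp hy) (Primrec.fst.comp (Primrec.snd.comp hy)))

theorem primrec_divisionCount {k : α → ℕ} {e : α → PointCode × PointCode} (hk : Primrec k)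
    (he : Primrec e) : Primrec fun a => divisionCount (k a) (e a) := by
  have h1 := Primrec.fst.comp he
  have h2 := Primrec.snd.comp he
  exact primrec_mul (primrec_two_pow hk) (primrec_succ (primrec_add
    (primrec_codeBound (Primrec.fst.comp h1) (Primrec.fst.comp h2))
    (primrec_codeBound (Primrec.snd.comp h1) (Primrec.snd.comp h2))))

theorem primrec_divisionPoints {k : α → ℕ} {e : α → PointCode × PointCode} (hk : Primrec k)
    (he : Primrec e) : Primrec fun a => divisionPoints (k a) (e a) := by
  have hN := primrec_divisionCount hk he
  refine Primrec.list_map (Primrec.list_range.comp (primrec_succ hN)) ?_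
  have hN' := hN.comp (Primrec.fst (α := α) (β := ℕ))
  have he' := he.comp (Primrec.fst (α := α) (β := ℕ))
  have h1 := Primrec.fst.comp he'
  have h2 := Primrec.snd.comp he'
  exact (primrec_interpolationCode hN' Primrec.snd (Primrec.fst.comp h1) (Primrec.fst.comp h2)).pair
    (primrec_interpolationCode hN' Primrec.snd (Primrec.snd.comp h1) (Primrec.snd.comp h2))

end Primrec

/-! ### From polygons to coverings -/

/-- Codes of the squares of radius `4 · 2⁻ᵏ` about points with spacing `2⁻ᵏ` on a polygon. -/
def squaresCode (k : ℕ) (w : PointCode × List PointCode) : List (PointCode × (ℕ × ℕ)) :=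
  (consecutivePairs (w.1 :: w.2)).flatMap fun e =>
    (divisionPoints k e).map fun v => (v, (3, 2 ^ k - 1))

theorem primrec_squaresCode : Primrec₂ squaresCode := by
  have hw : Primrec fun p : ℕ × (PointCode × List PointCode) => p.2.1 :: p.2.2 :=
    Primrec.list_cons.comp (Primrec.fst.comp Primrec.snd) (Primrec.snd.comp Primrec.snd)
  refine Primrec.list_flatMap (primrec_consecutivePairs.comp hw) ?_
  have hk : Primrec fun q : (ℕ × (PointCode × List PointCode)) × (PointCode × PointCode) =>
    q.1.1 := Primrec.fst.comp Primrec.fst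
  refine Primrec.list_map (primrec_divisionPoints hk Primrec.snd) ?_
  exact Primrec.snd.pair ((Primrec.const 3).pair
    (primrec_sub (primrec_two_pow (hk.comp Primrec.fst)) (Primrec.const 1)))

theorem mem_coverSet_coverOfCode {L : List (PointCode × (ℕ × ℕ))} {x : Plane} :
    x ∈ coverSet (coverOfCode L) ↔
      ∃ V ∈ L, x ∈ nbhd ((posRatOfCode V.2 : ℚ) : ℝ) (planePoint V.1) := by
  simp only [coverSet, coverOfCode, mem_iUnion, List.mem_toFinset, List.mem_map, exists_prop,
    exists_exists_and_eq_and]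
  rfl

theorem isBounded_coverSet (Q : Finset RatNbhd) : Bornology.IsBounded (coverSet Q) :=
  (Bornology.isBounded_biUnion_finset Q).2 fun _ _ => isBounded_nbhd _ _

theorem areClose_vertices_curve (k : ℕ) (w : PointCode × List PointCode) :
    AreClose ((1 / 2) ^ k) (⋃ V ∈ {V | V ∈ squaresCode k w}, {planePoint V.1})
      (polygonOfCode w).curve := by
  rw [curve_polygonOfCode]
  constructor
  · refine Subset.trans ?_ (subset_setNbhd_self (by positivity) _)
    intro x hx
    simp only [squaresCode, mem_ofPred_eq, List.mem_flatMap, List.mem_map, mem_iUnion,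
      exists_prop] at hx
    obtain ⟨_, ⟨e, he, v, hv, rfl⟩, rfl⟩ := hx
    exact mem_biUnion (show e ∈ {e | e ∈ consecutivePairs (w.1 :: w.2)} from he)
      (planePoint_mem_segment hv)
  · intro x hx
    obtain ⟨e, he, hxe⟩ := mem_iUnion₂.1 hx
    obtain ⟨v, hv, hxv⟩ := exists_mem_divisionPoints k hxe
    refine mem_setNbhd.2 ⟨planePoint v, ?_, hxv⟩
    exact mem_biUnion (x := (v, (3, 2 ^ k - 1)))
      (List.mem_flatMap.2 ⟨e, he, List.mem_map.2 ⟨v, hv, rfl⟩⟩) rfl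

theorem posRatOfCode_of_mem_squaresCode {k : ℕ} {w : PointCode × List PointCode}
    {V : PointCode × (ℕ × ℕ)} (hV : V ∈ squaresCode k w) :
    ((posRatOfCode V.2 : ℚ) : ℝ) = 4 * (1 / 2) ^ k := by
  simp only [squaresCode, List.mem_flatMap, List.mem_map] at hV
  obtain ⟨e, -, v, -, rfl⟩ := hV
  have : (((2 ^ k - 1 : ℕ) : ℝ) + 1) = 2 ^ k := by
    rw [Nat.cast_sub Nat.one_le_two_pow]
    push_cast
    ring
  simp only [posRatOfCode]
  push_cast
  rw [this, div_pow, one_pow]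
  ring

/-- The squares of radius `4 · 2⁻ᵏ` about the points that divide a polygon form a set that covers
everything `3 · 2⁻ᵏ`-close to the polygon. -/
theorem coverSet_squaresCode {k : ℕ} {w : PointCode × List PointCode} {C : Set Plane}
    (h : AreClose (3 * (1 / 2) ^ k) (polygonOfCode w).curve C) :
    C ⊆ coverSet (coverOfCode (squaresCode k w)) ∧
      AreClose (8 * (1 / 2) ^ k) (coverSet (coverOfCode (squaresCode k w))) C := by
  set S : Set Plane := ⋃ V ∈ {V | V ∈ squaresCode k w}, {planePoint V.1}
  have hpos : (0 : ℝ) < 4 * (1 / 2) ^ k := by positivity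
  have hcover : coverSet (coverOfCode (squaresCode k w)) = setNbhd (4 * (1 / 2) ^ k) S := by
    ext x
    simp only [mem_coverSet_coverOfCode, mem_setNbhd, S, mem_iUnion, mem_ofPred_eq,
      mem_singleton_iff, exists_prop]
    constructor
    · rintro ⟨V, hV, hx⟩
      exact ⟨_, ⟨V, hV, rfl⟩, posRatOfCode_of_mem_squaresCode hV ▸ hx⟩
    · rintro ⟨_, ⟨V, hV, rfl⟩, hx⟩
      exact ⟨V, hV, (posRatOfCode_of_mem_squaresCode hV).symm ▸ hx⟩
  -- The constant is `1 + 3`: the spacing of the division points plus the distance from the polygon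
  -- to `C`.
  have hSC : AreClose (4 * (1 / 2) ^ k) S C :=
    ((areClose_vertices_curve k w).trans h).mono (by linarith)
  rw [hcover]
  have hS : AreClose (4 * (1 / 2) ^ k) (setNbhd (4 * (1 / 2) ^ k) S) S :=
    ⟨Subset.rfl, (subset_setNbhd_self hpos S).trans (subset_setNbhd_self hpos _)⟩
  exact ⟨hSC.2, (hS.trans hSC).mono (by linarith)⟩

/-! ### From coverings to polygons -/

/-- The coded rational numbers satisfy `y - x < 2 · 2⁻ᵏ`. -/
def CodeSubLt (k : ℕ) (x y : ℕ × ℕ × ℕ) : Prop :=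
  2 ^ k * (y.1 * (x.2.2 + 1) + x.2.1 * (y.2.2 + 1)) <
    2 * ((x.2.2 + 1) * (y.2.2 + 1)) + 2 ^ k * (y.2.1 * (x.2.2 + 1) + x.1 * (y.2.2 + 1))

/-- Denominators are cleared and negative terms moved across, so that the test compares natural
numbers without subtraction. -/
theorem codeSubLt_iff {k : ℕ} {x y : ℕ × ℕ × ℕ} :
    CodeSubLt k x y ↔ (ratOfCode y : ℝ) - ratOfCode x < 2 * (1 / 2) ^ k := by
  have hx : (0 : ℝ) < x.2.2 + 1 := by positivity
  have hy : (0 : ℝ) < y.2.2 + 1 := by positivity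
  have h2 : (0 : ℝ) < 2 ^ k := by positivity
  simp only [CodeSubLt, ratOfCode]
  push_cast
  rw [div_sub_div _ _ hy.ne' hx.ne', div_pow, one_pow, mul_one_div,
    div_lt_div_iff₀ (mul_pos hy hx) h2, ← Nat.cast_lt (α := ℝ)]
  push_cast
  constructor <;> intro h <;> linarith

/-- The coded points differ by less than `2 · 2⁻ᵏ` in each coordinate. -/
def IsShortStep (k : ℕ) (e : PointCode × PointCode) : Prop :=
  (CodeSubLt k e.1.1 e.2.1 ∧ CodeSubLt k e.2.1 e.1.1) ∧
    CodeSubLt k e.1.2 e.2.2 ∧ CodeSubLt k e.2.2 e.1.2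

theorem isShortStep_iff {k : ℕ} {e : PointCode × PointCode} :
    IsShortStep k e ↔ planePoint e.2 ∈ nbhd (2 * (1 / 2) ^ k) (planePoint e.1) := by
  simp only [IsShortStep, codeSubLt_iff, nbhd, mem_ofPred_eq, planePoint_apply_zero,
    planePoint_apply_one, abs_sub_lt_iff]

/-- All squares of the list `L` have radius at most `2⁻ᵏ`, and `w` codes a polygon with short edges
whose vertices are the centres of these squares. -/
def IsPolygonThrough (k : ℕ) (L : List (PointCode × (ℕ × ℕ))) (w : PointCode × List PointCode) :
    Prop :=
  ((∀ V ∈ L, 2 ^ k * (V.2.1 + 1) ≤ V.2.2 + 1) ∧ ∀ e ∈ consecutivePairs (w.1 :: w.2),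
    IsShortStep k e) ∧ (∀ V ∈ L, ∃ v ∈ w.1 :: w.2, v = V.1) ∧ ∀ v ∈ w.1 :: w.2, ∃ V ∈ L, V.1 = v

section Primrec

variable {α : Type} [Primcodable α]

theorem primrecPred_codeSubLt {k : α → ℕ} {x y : α → ℕ × ℕ × ℕ} (hk : Primrec k)
    (hx : Primrec x) (hy : Primrec y) : PrimrecPred fun a => CodeSubLt (k a) (x a) (y a) := by
  have hx1 := Primrec.fst.comp hx
  have hx2 := Primrec.fst.comp (Primrec.snd.comp hx)
  have hx3 := primrec_succ (Primrec.snd.comp (Primrec.snd.comp hx))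
  have hy1 := Primrec.fst.comp hy
  have hy2 := Primrec.fst.comp (Primrec.snd.comp hy)
  have hy3 := primrec_succ (Primrec.snd.comp (Primrec.snd.comp hy))
  have hp := primrec_two_pow hk
  exact Primrec.nat_lt.comp
    (primrec_mul hp (primrec_add (primrec_mul hy1 hx3) (primrec_mul hx2 hy3)))
    (primrec_add (primrec_mul (Primrec.const 2) (primrec_mul hx3 hy3))
      (primrec_mul hp (primrec_add (primrec_mul hy2 hx3) (primrec_mul hx1 hy3))))

theorem primrecRel_isShortStep : PrimrecRel fun (e : PointCode × PointCode) k => IsShortStep k e := by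
  have he : Primrec fun p : (PointCode × PointCode) × ℕ => p.1 := Primrec.fst
  have h1 := Primrec.fst.comp he
  have h2 := Primrec.snd.comp he
  have h11 := Primrec.fst.comp h1
  have h12 := Primrec.snd.comp h1
  have h21 := Primrec.fst.comp h2
  have h22 := Primrec.snd.comp h2
  exact ((primrecPred_codeSubLt Primrec.snd h11 h21).and
    (primrecPred_codeSubLt Primrec.snd h21 h11)).and
    ((primrecPred_codeSubLt Primrec.snd h12 h22).and
      (primrecPred_codeSubLt Primrec.snd h22 h12))

/-- All quantifiers range over given lists. Membership is spelled out as the existence of an equal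
entry, which matches the closure of primitive recursive relations under such quantifiers. -/
theorem primrecPred_isPolygonThrough :
    PrimrecPred fun p : ℕ × List (PointCode × (ℕ × ℕ)) × (PointCode × List PointCode) =>
      IsPolygonThrough p.1 p.2.1 p.2.2 := by
  have hk : Primrec fun p : ℕ × List (PointCode × (ℕ × ℕ)) × (PointCode × List PointCode) => p.1 :=
    Primrec.fst
  have hL : Primrec fun p : ℕ × List (PointCode × (ℕ × ℕ)) × (PointCode × List PointCode) =>
    p.2.1 := Primrec.fst.comp Primrec.snd
  have hw : Primrec fun p : ℕ × List (PointCode × (ℕ × ℕ)) × (PointCode × List PointCode) =>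
      p.2.2.1 :: p.2.2.2 :=
    Primrec.list_cons.comp (Primrec.fst.comp (Primrec.snd.comp Primrec.snd))
      (Primrec.snd.comp (Primrec.snd.comp Primrec.snd))
  have hsmall : PrimrecRel fun (V : PointCode × (ℕ × ℕ)) (k : ℕ) =>
      2 ^ k * (V.2.1 + 1) ≤ V.2.2 + 1 :=
    Primrec.nat_le.comp
      (primrec_mul (primrec_two_pow Primrec.snd)
        (primrec_succ (Primrec.fst.comp (Primrec.snd.comp Primrec.fst))))
      (primrec_succ (Primrec.snd.comp (Primrec.snd.comp Primrec.fst)))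
  have hvertex : PrimrecRel fun (v : PointCode) (V : PointCode × (ℕ × ℕ)) => v = V.1 :=
    Primrec.eq.comp Primrec.fst (Primrec.fst.comp Primrec.snd)
  have hvertex' : PrimrecRel fun (V : PointCode × (ℕ × ℕ)) (W : List PointCode) =>
      ∃ v ∈ W, v = V.1 :=
    hvertex.exists_mem_list.comp Primrec.snd Primrec.fst
  have hcentre : PrimrecRel fun (V : PointCode × (ℕ × ℕ)) (v : PointCode) => V.1 = v :=
    Primrec.eq.comp (Primrec.fst.comp Primrec.fst) Primrec.snd
  have hcentre' : PrimrecRel fun (v : PointCode) (L : List (PointCode × (ℕ × ℕ))) =>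
      ∃ V ∈ L, V.1 = v :=
    hcentre.exists_mem_list.comp Primrec.snd Primrec.fst
  exact ((hsmall.forall_mem_list.comp hL hk).and
    (primrecRel_isShortStep.forall_mem_list.comp (primrec_consecutivePairs.comp hw) hk)).and
    ((hvertex'.forall_mem_list.comp hL hw).and (hcentre'.forall_mem_list.comp hw hL))

end Primrec

theorem posRatOfCode_le_iff {k : ℕ} {r : ℕ × ℕ} :
    ((posRatOfCode r : ℚ) : ℝ) ≤ (1 / 2) ^ k ↔ 2 ^ k * (r.1 + 1) ≤ r.2 + 1 := by
  simp only [posRatOfCode]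
  push_cast
  rw [div_pow, one_pow, div_le_div_iff₀ (by positivity) (by positivity),
    ← Nat.cast_le (α := ℝ)]
  push_cast
  rw [one_mul, mul_comm]

theorem posRatOfCode_pos (r : ℕ × ℕ) : (0 : ℝ) < (posRatOfCode r : ℚ) :=
  Rat.cast_pos.2 (posRatOfCode r).2

theorem planePoint_mem_coverSet {L : List (PointCode × (ℕ × ℕ))} {V : PointCode × (ℕ × ℕ)}
    (hV : V ∈ L) : planePoint V.1 ∈ coverSet (coverOfCode L) :=
  mem_coverSet_coverOfCode.2 ⟨V, hV, mem_nbhd_self (posRatOfCode_pos _) _⟩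

/-- A polygon through the centres of the small squares of a covering of `C` is close to `C`. -/
theorem IsPolygonThrough.areClose {k : ℕ} {L : List (PointCode × (ℕ × ℕ))}
    {w : PointCode × List PointCode} (h : IsPolygonThrough k L w) {C : Set Plane}
    (hcov : C ⊆ coverSet (coverOfCode L))
    (hclose : AreClose ((1 / 2) ^ k) (coverSet (coverOfCode L)) C) :
    AreClose (3 * (1 / 2) ^ k) (polygonOfCode w).curve C := by
  obtain ⟨⟨hsmall, hstep⟩, hLw, hwL⟩ := h
  have h1 := areClose_curve_vertices (by positivity : (0 : ℝ) < 2 * (1 / 2) ^ k)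
    fun e he => isShortStep_iff.1 (hstep e he)
  have h2 : AreClose ((1 / 2) ^ k) (planePoint '' {v | v ∈ w.1 :: w.2}) C := by
    constructor
    · rintro _ ⟨v, hv, rfl⟩
      obtain ⟨V, hV, rfl⟩ := hwL v hv
      exact hclose.1 (planePoint_mem_coverSet hV)
    · intro x hx
      obtain ⟨V, hV, hxV⟩ := mem_coverSet_coverOfCode.1 (hcov hx)
      obtain ⟨v, hv, rfl⟩ := hLw V hV
      exact mem_setNbhd.2 ⟨_, ⟨_, hv, rfl⟩, nbhd_mono (posRatOfCode_le_iff.2 (hsmall V hV)) _ hxV⟩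
  -- Edges contribute `2 · 2⁻ᵏ` and vertices `2⁻ᵏ`.
  exact (h1.trans h2).mono (by linarith)

/-- Connectedness of `C` provides a polygon through the centres of a covering by small squares. -/
theorem exists_isPolygonThrough {C : Set Plane} (hC : IsPreconnected C) (hne : C.Nonempty) {k : ℕ}
    {L : List (PointCode × (ℕ × ℕ))} (hcov : C ⊆ coverSet (coverOfCode L))
    (hclose : AreClose ((1 / 2) ^ k) (coverSet (coverOfCode L)) C)
    (hsmall : ∀ V ∈ L, ((posRatOfCode V.2 : ℚ) : ℝ) ≤ (1 / 2) ^ k) :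
    ∃ w, IsPolygonThrough k L w := by
  set M : List PointCode := L.map Prod.fst
  -- Enlarged to the common radius `2⁻ᵏ`, the squares still cover `C`. Each of them meets `C`,
  -- because its centre belongs to the covering set and so lies within `2⁻ᵏ` of `C`.
  have hpath := reflTransGen_of_isPreconnected (κ := PointCode) hC (L := M) (c := planePoint)
    (δ := (1 / 2) ^ k)
    (fun x hx => by
      obtain ⟨V, hV, hxV⟩ := mem_coverSet_coverOfCode.1 (hcov hx)
      exact ⟨V.1, List.mem_map.2 ⟨V, hV, rfl⟩, nbhd_mono (hsmall V hV) _ hxV⟩)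
    (fun i hi => by
      obtain ⟨V, hV, rfl⟩ := List.mem_map.1 hi
      obtain ⟨x, hx, hVx⟩ := mem_setNbhd.1 (hclose.1 (planePoint_mem_coverSet hV))
      exact ⟨x, hx, nbhd_symm hVx⟩)
  obtain ⟨x, hx⟩ := hne
  obtain ⟨V, hV, -⟩ := mem_coverSet_coverOfCode.1 (hcov hx)
  obtain ⟨l, hl1, hl2, hl3⟩ := exists_isChain_of_reflTransGen (fun _ _ h => h.1) hpath M
    (fun _ h => h) V.1 (List.mem_map.2 ⟨V, hV, rfl⟩)
  refine ⟨(V.1, l), ⟨fun V hV => posRatOfCode_le_iff.1 (hsmall V hV), fun e he => ?_⟩,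
    fun V hV => ⟨V.1, hl2 _ (List.mem_map.2 ⟨V, hV, rfl⟩), rfl⟩,
    fun v hv => List.mem_map.1 (hl3 v hv)⟩
  rw [isShortStep_iff]
  exact rel_of_mem_consecutivePairs
    (R := fun a b => planePoint b ∈ nbhd (2 * (1 / 2) ^ k) (planePoint a))
    (fun a => mem_nbhd_self (by positivity) _) (hl1.imp fun _ _ h => h.2) he

/-- The squares of good coverings of a rectifiable curve become small. -/
theorem IsRectifiableCurve.exists_small_squares {C : Set Plane} (hC : IsRectifiableCurve C)
    {g : ℕ → List (PointCode × (ℕ × ℕ))}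
    (hg : ∀ m, AreClose ((1 / 2) ^ m) (coverSet (coverOfCode (g m))) C) (k : ℕ) :
    ∃ m, k ≤ m ∧ ∀ V ∈ g m, ((posRatOfCode V.2 : ℚ) : ℝ) ≤ (1 / 2) ^ k := by
  obtain ⟨δ, hδ, hnot⟩ := hC.exists_not_nbhd_subset_setNbhd
    (by positivity : (0 : ℝ) < (1 / 2) ^ k)
  obtain ⟨m, hm⟩ := exists_pow_lt_of_lt_one hδ (by norm_num : (1 / 2 : ℝ) < 1)
  refine ⟨max k m, le_max_left _ _, fun V hV => ?_⟩
  by_contra! hlt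
  -- A larger square would place a square of radius `2⁻ᵏ` inside the `δ`-neighbourhood of `C`.
  refine hnot (planePoint V.1) fun x hx => setNbhd_mono ?_ C ((hg (max k m)).1
    (mem_coverSet_coverOfCode.2 ⟨V, hV, nbhd_mono hlt.le _ hx⟩))
  exact (pow_le_pow_of_le_one (by norm_num) (by norm_num) (le_max_right k m)).trans hm.le

theorem IsRectifiableCurve.exists_polygons {C : Set Plane} (hC : IsRectifiableCurve C)
    (hK : IsKComputable C) : ∃ f : ℕ → PointCode × List PointCode, Computable f ∧
      ∀ n, AreClose (3 * (1 / 2) ^ (n + 3)) (polygonOfCode (f n)).curve C := by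
  obtain ⟨Q, ⟨g, hg, hgQ⟩, hQ⟩ := hK
  simp only [← hgQ] at hQ
  have hclose : ∀ m, AreClose ((1 / 2) ^ m) (coverSet (coverOfCode (g m))) C := fun m =>
    areClose_of_hausdorffDistance_lt (hC.nonempty.mono (hQ m).1) hC.nonempty
      (isBounded_coverSet _) hC.isCompact.isBounded (hQ m).2
  -- The search runs over the index of the covering as well as the polygon, since it is not known in
  -- advance which covering has small enough squares.
  let P : ℕ → ℕ × (PointCode × List PointCode) → Prop := fun n b =>
    n + 3 ≤ b.1 ∧ IsPolygonThrough (n + 3) (g b.1) b.2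
  have hP : ComputablePred fun p : ℕ × (ℕ × (PointCode × List PointCode)) => P p.1 p.2 := by
    have hprim : PrimrecPred fun q :
        (ℕ × ℕ) × List (PointCode × (ℕ × ℕ)) × (PointCode × List PointCode) =>
        q.1.1 + 3 ≤ q.1.2 ∧ IsPolygonThrough (q.1.1 + 3) q.2.1 q.2.2 := by
      have hn : Primrec fun q :
          (ℕ × ℕ) × List (PointCode × (ℕ × ℕ)) × (PointCode × List PointCode) => q.1.1 + 3 :=
        primrec_add (Primrec.fst.comp Primrec.fst) (Primrec.const 3)
      exact (Primrec.nat_le.comp hn (Primrec.snd.comp Primrec.fst)).and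
        (primrecPred_isPolygonThrough.comp (hn.pair Primrec.snd))
    have harg : Computable fun p : ℕ × (ℕ × (PointCode × List PointCode)) =>
        ((p.1, p.2.1), g p.2.1, p.2.2) := by
      have h1 : Computable fun p : ℕ × (ℕ × (PointCode × List PointCode)) => p.2.1 :=
        Computable.fst.comp Computable.snd
      exact (Computable.fst.pair h1).pair
        ((hg.comp h1).pair (Computable.snd.comp Computable.snd))
    exact PrimrecPred.comp_computable hprim harg
  obtain ⟨f, hf, hfP⟩ := exists_computable_choice hP fun n => by
    obtain ⟨m, hkm, hm⟩ := hC.exists_small_squares hclose (n + 3)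
    obtain ⟨w, hw⟩ := exists_isPolygonThrough hC.isPreconnected hC.nonempty (hQ m).1
      ((hclose m).mono (pow_le_pow_of_le_one (by norm_num) (by norm_num) hkm)) hm
    exact ⟨(m, w), hkm, hw⟩
  refine ⟨fun n => (f n).2, Computable.snd.comp hf, fun n => ?_⟩
  exact (hfP n).2.areClose (hQ _).1
    ((hclose _).mono (pow_le_pow_of_le_one (by norm_num) (by norm_num) (hfP n).1))

end CompCurve

/-! ### The equivalence -/

theorem corollary2p3 (C : Set CompCurve.Plane) (hC : CompCurve.IsRectifiableCurve C) :
    CompCurve.IsKComputable C ↔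
      ∃ p : ℕ → CompCurve.RatPolygon,
        CompCurve.IsComputableSeq CompCurve.polygonOfCode p ∧
        (∀ n : ℕ, CompCurve.hausdorffDistance
          (CompCurve.RatPolygon.curve (p n)) (CompCurve.RatPolygon.curve (p (n + 1)))
            ≤ (1 / 2 : ℝ) ^ n) ∧
        Filter.Tendsto
          (fun n => CompCurve.hausdorffDistance (CompCurve.RatPolygon.curve (p n)) C)
          Filter.atTop (nhds 0) := by
  constructor
  · intro hK
    obtain ⟨f, hf, hclose⟩ := hC.exists_polygons hK
    refine ⟨fun n => CompCurve.polygonOfCode (f n), ⟨f, hf, fun _ => rfl⟩, fun n => ?_, ?_⟩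
    · refine (((hclose n).trans (hclose (n + 1)).symm).hausdorffDistance_le
        (CompCurve.nonempty_curve _)).trans ?_
      have : (0 : ℝ) < (1 / 2) ^ n := by positivity
      rw [pow_add, pow_add, pow_add]
      linarith
    · have hlim : Filter.Tendsto (fun n : ℕ => 3 * (1 / 2 : ℝ) ^ (n + 3)) Filter.atTop (nhds 0) := by
        simpa using ((tendsto_pow_atTop_nhds_zero_of_lt_one (by norm_num : (0 : ℝ) ≤ 1 / 2)
          (by norm_num)).comp (Filter.tendsto_add_atTop_nat 3)).const_mul 3
      exact squeeze_zero
        (fun n => CompCurve.hausdorffDistance_nonneg (CompCurve.nonempty_curve _))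
        (fun n => (hclose n).hausdorffDistance_le (CompCurve.nonempty_curve _)) hlim
  · rintro ⟨p, ⟨g, hg, hgp⟩, hstep, hlim⟩
    -- The limit bound has constant 2; passing from distance to closeness needs a strictly larger
    -- one.
    have hclose : ∀ m, CompCurve.AreClose (3 * (1 / 2) ^ m)
        (CompCurve.polygonOfCode (g m)).curve C := by
      intro m
      have hpos : (0 : ℝ) < (1 / 2) ^ m := by positivity
      have hle := CompCurve.hausdorffDistance_limit_le (fun n => CompCurve.nonempty_curve (p n))
        (fun n => CompCurve.isBounded_curve (p n)) hC.nonempty hC.isCompact.isBounded hstep hlim m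
      rw [hgp]
      exact CompCurve.areClose_of_hausdorffDistance_lt (CompCurve.nonempty_curve _) hC.nonempty
        (CompCurve.isBounded_curve _) hC.isCompact.isBounded (hle.trans_lt (by linarith))
    have hn : Computable fun n : ℕ => n + 4 := (Primrec.nat_add.comp .id (.const 4)).to_comp
    -- With the shift by 4 the closeness is `8 · 2⁻⁽ⁿ⁺⁴⁾ = 2⁻ⁿ / 2`, strictly below `2⁻ⁿ`.
    refine ⟨fun n => CompCurve.coverOfCode (CompCurve.squaresCode (n + 4) (g (n + 4))),
      ⟨_, CompCurve.primrec_squaresCode.to_comp.comp hn (hg.comp hn), fun _ => rfl⟩, fun n => ?_⟩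
    obtain ⟨hcov, h8⟩ := CompCurve.coverSet_squaresCode (hclose (n + 4))
    refine ⟨hcov, (h8.hausdorffDistance_le (hC.nonempty.mono hcov)).trans_lt ?_⟩
    have : (0 : ℝ) < (1 / 2) ^ n := by positivity
    rw [pow_add]
    linarith
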